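/- **Corollary 2.6.** For a measurable function $f$ on $\mathbb{R}^2$ and $1\le p\le\infty$ put $$\big\|\,\|f\|_{L^p_x}\big\|_{L^\infty_y}=\operatorname*{ess\,sup}_{y\in\mathbb{R}}\|f(\cdot,y)\|_{L^p(\mathbb{R})},\qquad \big\|\,\|f\|_{L^\infty_y}\big\|_{L^p_x}=\big\|\,x\mapsto\operatorname*{ess\,sup}_{y\in\mathbb{R}}|f(x,y)|\,\big\|_{L^p(\mathbb{R})}.$$ Let $2\le p\le\infty$. Then there is no finite constant $C_p\ge 0$ such that $$\big\|\,\|\partial_x\partial_y u\|_{L^p_x}\big\|_{L^\infty_y}\le C_p\,\big\|\,\|\Delta u\|_{L^\infty_y}\big\|_{L^p_x}$$ for all Schwartz functions $u$ on $\mathbb{R}^2$, where $\Delta=\partial_x^2+\partial_y^2$. This holds both for complex-valued and for real-valued Schwartz functions $u$. -/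

import Mathlib

open MeasureTheory
open scoped ENNReal NNReal SchwartzMap LineDeriv Laplacian

/-- The mixed norm `‖ ‖f(x, y)‖_{L^p_x} ‖_{L^∞_y}` of a function on the plane: the `L^p` norm in the
first variable is taken first, then the essential supremum over the second variable. -/
noncomputable def normLinftyYLpX {F : Type*} [NormedAddCommGroup F] (p : ℝ≥0∞)
    (f : EuclideanSpace ℝ (Fin 2) → F) : ℝ≥0∞ :=
  eLpNorm (fun y : ℝ => eLpNorm (fun x : ℝ => f !₂[x, y]) p volume) ∞ volume

/-- The mixed norm `‖ ‖f(x, y)‖_{L^∞_y} ‖_{L^p_x}` of a function on the plane: the essential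
supremum over the second variable is taken first, then the `L^p` norm in the first variable. -/
noncomputable def normLpXLinftyY {F : Type*} [NormedAddCommGroup F] (p : ℝ≥0∞)
    (f : EuclideanSpace ℝ (Fin 2) → F) : ℝ≥0∞ :=
  eLpNorm (fun x : ℝ => eLpNorm (fun y : ℝ => f !₂[x, y]) ∞ volume) p volume

/-!
Fix a cutoff `φ`, a unit vector `c` and a compactly supported `ψ` with `ψ(t) = t c` near `0`, and
superpose the waves `4⁻ᵏ φ(x) cos (2ᵏ x) ψ(2ᵏ y)`, `k < N`. Up to a geometric series, the Laplacian
is `φ(x) ∑ cos (2ᵏ x) (ψ'' - ψ)(2ᵏ y)`, which is bounded uniformly in `N` because `ψ'' - ψ` vanishes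
at the origin and outside a bounded set. For `y` close to `0`, however, the mixed derivative is
`-∑ sin (2ᵏ x) c` where `φ = 1`; by orthogonality its `L²` norm on `(0, 2π)` is `√(N π)`, so for
every `p ≥ 2` its `L^p` norm there is unbounded in `N`.
-/

open Filter Topology Real

local notation "ℝ²" => EuclideanSpace ℝ (Fin 2)
local notation "e₁" => (EuclideanSpace.single 0 1 : ℝ²)
local notation "e₂" => (EuclideanSpace.single 1 1 : ℝ²)

section Tensor

variable {F : Type*} [NormedAddCommGroup F] [NormedSpace ℝ F] {a : ℝ → ℝ} {b : ℝ → F}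
  {u : 𝓢(ℝ², F)}

/-- The tensor product `(x, y) ↦ a(x) b(y)` of two functions of one real variable, as a function on
the plane. -/
def tensor (a : ℝ → ℝ) (b : ℝ → F) (v : ℝ²) : F := a (v 0) • b (v 1)

theorem exists_schwartzMap_coe_eq_tensor
    (ha : ContDiff ℝ (⊤ : ℕ∞) a) (ha_supp : HasCompactSupport a)
    (hb : ContDiff ℝ (⊤ : ℕ∞) b) (hb_supp : HasCompactSupport b) :
    ∃ u : 𝓢(ℝ², F), ⇑u = tensor a b := by
  have h_smooth : ContDiff ℝ (⊤ : ℕ∞) (tensor a b) := by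
    unfold tensor
    fun_prop
  have h_supp : HasCompactSupport (tensor a b) := by
    let e : ℝ² ≃ₜ ℝ × ℝ :=
      (EuclideanSpace.equiv (Fin 2) ℝ).toHomeomorph.trans .finTwoArrow
    refine .intro (e.isCompact_preimage.2 (ha_supp.isCompact.prod hb_supp.isCompact))
      fun v hv => ?_
    by_contra h
    rw [tensor, smul_eq_zero, not_or] at h
    exact hv ⟨subset_tsupport a h.1, subset_tsupport b h.2⟩
  exact ⟨h_supp.toSchwartzMap h_smooth, rfl⟩

theorem coe_lineDerivOp_fst (hu : ⇑u = tensor a b) (ha : Differentiable ℝ a) :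
    ⇑(∂_{e₁} u : 𝓢(ℝ², F)) = tensor (deriv a) b := by
  ext v
  have h : HasDerivAt (fun t => a (v 0 + t) • b (v 1)) (deriv a (v 0) • b (v 1)) 0 :=
    HasDerivAt.smul_const (.comp_const_add (v 0) 0 (by simpa using (ha (v 0)).hasDerivAt)) _
  simpa [SchwartzMap.lineDerivOp_apply, lineDeriv, hu, tensor] using h.deriv

theorem coe_lineDerivOp_snd (hu : ⇑u = tensor a b) (hb : Differentiable ℝ b) :
    ⇑(∂_{e₂} u : 𝓢(ℝ², F)) = tensor a (deriv b) := by
  ext v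
  have h : HasDerivAt (fun t => a (v 0) • b (v 1 + t)) (a (v 0) • deriv b (v 1)) 0 :=
    HasDerivAt.const_smul _ (.comp_const_add (v 1) 0 (by simpa using (hb (v 1)).hasDerivAt))
  simpa [SchwartzMap.lineDerivOp_apply, lineDeriv, hu, tensor] using h.deriv

theorem coe_laplacian (hu : ⇑u = tensor a b) (ha : ContDiff ℝ 2 a) (hb : ContDiff ℝ 2 b) :
    ⇑(Δ u : 𝓢(ℝ², F)) = tensor (deriv (deriv a)) b + tensor a (deriv (deriv b)) := by
  have h_xx := coe_lineDerivOp_fst (coe_lineDerivOp_fst hu (ha.differentiable two_ne_zero))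
    ha.differentiable_deriv_two
  have h_yy := coe_lineDerivOp_snd (coe_lineDerivOp_snd hu (hb.differentiable two_ne_zero))
    hb.differentiable_deriv_two
  rw [SchwartzMap.laplacian_eq_sum (EuclideanSpace.basisFun (Fin 2) ℝ)]
  simp [Fin.sum_univ_two, h_xx, h_yy]

end Tensor

section WavePacket

variable {F : Type*} [NormedAddCommGroup F] [NormedSpace ℝ F] {φ : ℝ → ℝ} {ψ : ℝ → F} {ω : ℝ}

theorem deriv_mul_cos (hφ : Differentiable ℝ φ) (ω : ℝ) :
    deriv (fun x => φ x * cos (ω * x)) =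
      fun x => deriv φ x * cos (ω * x) - ω * (φ x * sin (ω * x)) := by
  ext x
  have h_cos : HasDerivAt (fun x => cos (ω * x)) (-sin (ω * x) * ω) x :=
    (hasDerivAt_const_mul ω).cos
  rw [((hφ x).hasDerivAt.fun_mul h_cos).deriv]
  ring

theorem deriv_mul_sin (hφ : Differentiable ℝ φ) (ω : ℝ) :
    deriv (fun x => φ x * sin (ω * x)) =
      fun x => deriv φ x * sin (ω * x) + ω * (φ x * cos (ω * x)) := by
  ext x
  have h_sin : HasDerivAt (fun x => sin (ω * x)) (cos (ω * x) * ω) x :=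
    (hasDerivAt_const_mul ω).sin
  rw [((hφ x).hasDerivAt.fun_mul h_sin).deriv]
  ring

theorem deriv_deriv_mul_cos (hφ : ContDiff ℝ 2 φ) (ω : ℝ) :
    deriv (deriv fun x => φ x * cos (ω * x)) = fun x =>
      deriv (deriv φ) x * cos (ω * x) - 2 * ω * (deriv φ x * sin (ω * x)) -
        ω ^ 2 * (φ x * cos (ω * x)) := by
  have hφ₁ : Differentiable ℝ φ := hφ.differentiable two_ne_zero
  have hφ₂ : Differentiable ℝ (deriv φ) := hφ.differentiable_deriv_two
  ext x
  rw [deriv_mul_cos hφ₁, deriv_fun_sub (by fun_prop) (by fun_prop), deriv_const_mul_field,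
    deriv_mul_cos hφ₂, deriv_mul_sin hφ₁]
  ring

theorem deriv_smul_comp_mul_left (c ω : ℝ) (ψ : ℝ → F) :
    deriv (fun y => c • ψ (ω * y)) = fun y => (c * ω) • deriv ψ (ω * y) := by
  ext y
  rw [deriv_fun_const_smul_field, deriv_comp_mul_left, smul_smul]

variable {u : 𝓢(ℝ², F)}

/-- The wave `cos (ω x)` with envelope `φ` in `x`, times the profile `ψ` at scale `1 / ω` in `y`.
The amplitude `ω⁻²` makes both pure second derivatives of size one. -/
noncomputable def wavePacket (φ : ℝ → ℝ) (ψ : ℝ → F) (ω : ℝ) : ℝ² → F :=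
  tensor (fun x => φ x * cos (ω * x)) fun y => (ω ^ 2)⁻¹ • ψ (ω * y)

theorem exists_schwartzMap_coe_eq_wavePacket
    (hφ : ContDiff ℝ (⊤ : ℕ∞) φ) (hφ_supp : HasCompactSupport φ)
    (hψ : ContDiff ℝ (⊤ : ℕ∞) ψ) (hψ_supp : HasCompactSupport ψ) (hω : ω ≠ 0) :
    ∃ u : 𝓢(ℝ², F), ⇑u = wavePacket φ ψ ω :=
  exists_schwartzMap_coe_eq_tensor (by fun_prop) hφ_supp.mul_right (by fun_prop)
    (hψ_supp.comp_homeomorph (.mulLeft₀ ω hω)).smul_left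

theorem mixedDeriv_apply_of_coe_eq_wavePacket (hu : ⇑u = wavePacket φ ψ ω)
    (hφ : Differentiable ℝ φ) (hψ : Differentiable ℝ ψ) (hω : ω ≠ 0) (x y : ℝ) :
    (∂_{e₁} (∂_{e₂} u)) !₂[x, y] =
      (ω⁻¹ * (deriv φ x * cos (ω * x)) - φ x * sin (ω * x)) • deriv ψ (ω * y) := by
  rw [coe_lineDerivOp_fst (coe_lineDerivOp_snd hu (by fun_prop)) (by fun_prop), deriv_mul_cos hφ,
    deriv_smul_comp_mul_left]
  simp only [tensor, Matrix.cons_val_zero, Matrix.cons_val_one, smul_smul]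
  congr 1
  field_simp

theorem laplacian_apply_of_coe_eq_wavePacket (hu : ⇑u = wavePacket φ ψ ω)
    (hφ : ContDiff ℝ 2 φ) (hψ : ContDiff ℝ 2 ψ) (hω : ω ≠ 0) (x y : ℝ) :
    Δ u !₂[x, y] =
      ((ω ^ 2)⁻¹ * (deriv (deriv φ) x * cos (ω * x)) - 2 * ω⁻¹ * (deriv φ x * sin (ω * x))) •
          ψ (ω * y) +
        (φ x * cos (ω * x)) • (deriv (deriv ψ) (ω * y) - ψ (ω * y)) := by
  rw [coe_laplacian hu (by fun_prop) (by fun_prop), deriv_deriv_mul_cos hφ,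
    deriv_smul_comp_mul_left, deriv_smul_comp_mul_left]
  simp only [tensor, Pi.add_apply, Matrix.cons_val_zero, Matrix.cons_val_one]
  match_scalars
  · field_simp
    ring
  · field_simp

theorem norm_laplacian_apply_le_of_coe_eq_wavePacket (hu : ⇑u = wavePacket φ ψ ω)
    (hφ : ContDiff ℝ 2 φ) (hψ : ContDiff ℝ 2 ψ) (hω : 1 ≤ ω) {B : ℝ} (hB : ∀ t, ‖ψ t‖ ≤ B)
    (x y : ℝ) :
    ‖Δ u !₂[x, y]‖ ≤ B * (|deriv (deriv φ) x| + 2 * |deriv φ x|) * ω⁻¹ +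
      |φ x| * ‖deriv (deriv ψ) (ω * y) - ψ (ω * y)‖ := by
  have hω₀ : 0 < ω := one_pos.trans_le hω
  have h_inv : (ω ^ 2)⁻¹ ≤ ω⁻¹ := by gcongr; exact le_self_pow₀ hω two_ne_zero
  have h_cos := abs_cos_le_one (ω * x)
  have h_sin := abs_sin_le_one (ω * x)
  have h_coeff : |(ω ^ 2)⁻¹ * (deriv (deriv φ) x * cos (ω * x)) -
      2 * ω⁻¹ * (deriv φ x * sin (ω * x))| ≤
      (|deriv (deriv φ) x| + 2 * |deriv φ x|) * ω⁻¹ := by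
    calc _ ≤ (ω ^ 2)⁻¹ * (|deriv (deriv φ) x| * |cos (ω * x)|) +
          2 * ω⁻¹ * (|deriv φ x| * |sin (ω * x)|) := by
          refine (abs_sub _ _).trans_eq ?_
          simp only [abs_mul, abs_inv, abs_pow, abs_of_pos hω₀, abs_two]
      _ ≤ ω⁻¹ * (|deriv (deriv φ) x| * 1) + 2 * ω⁻¹ * (|deriv φ x| * 1) := by gcongr
      _ = _ := by ring
  rw [laplacian_apply_of_coe_eq_wavePacket hu hφ hψ hω₀.ne']
  refine (norm_add_le _ _).trans ?_
  rw [norm_smul, norm_smul, norm_mul, norm_eq_abs, norm_eq_abs, norm_eq_abs]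
  calc _ ≤ (|deriv (deriv φ) x| + 2 * |deriv φ x|) * ω⁻¹ * B +
        |φ x| * 1 * ‖deriv (deriv ψ) (ω * y) - ψ (ω * y)‖ := by
        gcongr
        exact hB _
    _ = _ := by ring

end WavePacket

section DyadicSums

theorem sum_norm_comp_two_pow_smul_le {E F : Type*} [NormedAddCommGroup E] [NormedSpace ℝ E]
    [SeminormedAddCommGroup F] {h : E → F} {C R : ℝ≥0} (h_lin : ∀ x, ‖h x‖ ≤ C * ‖x‖)
    (h_supp : ∀ x, R < ‖x‖ → h x = 0) (N : ℕ) (x : E) :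
    ∑ k ∈ Finset.range N, ‖h ((2 : ℝ) ^ k • x)‖ ≤ 2 * R * C := by
  induction N with
  | zero => simpa using by positivity
  | succ N ih =>
    rcases lt_or_ge (R : ℝ) ‖(2 : ℝ) ^ N • x‖ with h_far | h_near
    · rwa [Finset.sum_range_succ, h_supp _ h_far, norm_zero, add_zero]
    · have h_pow (k : ℕ) : ‖(2 : ℝ) ^ k • x‖ = 2 ^ k * ‖x‖ := by simp [norm_smul]
      rw [h_pow] at h_near
      calc ∑ k ∈ Finset.range (N + 1), ‖h ((2 : ℝ) ^ k • x)‖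
          ≤ ∑ k ∈ Finset.range (N + 1), 2 ^ k * (C * ‖x‖) := by
            gcongr with k
            exact (h_lin _).trans_eq (by rw [h_pow]; ring)
        _ = (2 ^ (N + 1) - 1) * (C * ‖x‖) := by
            rw [← Finset.sum_mul, geom_sum_eq (by norm_num)]
            norm_num
        _ ≤ 2 ^ (N + 1) * (C * ‖x‖) := by gcongr; linarith
        _ = 2 * (2 ^ N * ‖x‖) * C := by ring
        _ ≤ 2 * R * C := by gcongr

theorem exists_sum_norm_comp_two_pow_smul_le {E F : Type*} [NormedAddCommGroup E]
    [NormedSpace ℝ E] [NormedAddCommGroup F] [NormedSpace ℝ F] {h : E → F}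
    (h_smooth : ContDiff ℝ 1 h) (h_supp : HasCompactSupport h) (h_zero : h 0 = 0) :
    ∃ M : ℝ, ∀ N x, ∑ k ∈ Finset.range N, ‖h ((2 : ℝ) ^ k • x)‖ ≤ M := by
  obtain ⟨C, hC⟩ := h_smooth.lipschitzWith_of_hasCompactSupport h_supp one_ne_zero
  obtain ⟨R, hR, h_far⟩ := h_supp.exists_pos_le_norm
  lift R to ℝ≥0 using hR.le
  refine ⟨2 * R * C, sum_norm_comp_two_pow_smul_le (fun x => ?_) fun x hx => h_far x hx.le⟩
  simpa [h_zero] using hC.norm_sub_le x 0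

end DyadicSums

section LacunarySines

theorem integral_cos_int_mul (m : ℤ) :
    ∫ x in 0..2 * π, cos (m * x) = if m = 0 then 2 * π else 0 := by
  split_ifs with hm
  · simp [hm]
  · have h_sin : sin (m * (2 * π)) = 0 := by
      simpa [mul_assoc, mul_left_comm] using sin_int_mul_pi (2 * m)
    rw [intervalIntegral.integral_comp_mul_left cos (Int.cast_ne_zero.2 hm), integral_cos, h_sin]
    simp

theorem integral_sin_nat_mul_mul_sin_nat_mul {m : ℕ} (hm : m ≠ 0) (n : ℕ) :
    ∫ x in 0..2 * π, sin (m * x) * sin (n * x) = if m = n then π else 0 := by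
  have h_prod (x : ℝ) : sin (m * x) * sin (n * x) =
      (1 / 2) * (cos (((m - n : ℤ) : ℝ) * x) - cos (((m + n : ℤ) : ℝ) * x)) := by
    push_cast
    rw [sub_mul, add_mul, cos_sub, cos_add]
    ring
  have h_sum : (m + n : ℤ) ≠ 0 := by omega
  simp only [h_prod]
  rw [intervalIntegral.integral_const_mul, intervalIntegral.integral_sub
    (Continuous.intervalIntegrable (by fun_prop) _ _)
    (Continuous.intervalIntegrable (by fun_prop) _ _), integral_cos_int_mul, integral_cos_int_mul]
  simp only [h_sum, sub_eq_zero, Nat.cast_inj, if_false]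
  split_ifs <;> ring

theorem integral_sq_sum_mul_sin {ι : Type*} (s : Finset ι) (a : ι → ℝ) {n : ι → ℕ}
    (hn : ∀ i ∈ s, n i ≠ 0) (hn_inj : Set.InjOn n s) :
    ∫ x in 0..2 * π, (∑ i ∈ s, a i * sin (n i * x)) ^ 2 = (∑ i ∈ s, a i ^ 2) * π := by
  classical
  have h_orth : ∀ i ∈ s, ∀ j ∈ s,
      ∫ x in 0..2 * π, a i * sin (n i * x) * (a j * sin (n j * x)) =
        if i = j then a i ^ 2 * π else 0 := fun i hi j hj => by
    simp only [mul_mul_mul_comm (a i)]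
    rw [intervalIntegral.integral_const_mul, integral_sin_nat_mul_mul_sin_nat_mul (hn i hi)]
    simp only [hn_inj.eq_iff hi hj]
    split_ifs with h
    · rw [h, sq]
    · exact mul_zero _
  simp only [sq (Finset.sum s _), Finset.sum_mul_sum]
  rw [intervalIntegral.integral_finsetSum
    fun _ _ => Continuous.intervalIntegrable (by fun_prop) _ _, Finset.sum_mul]
  refine Finset.sum_congr rfl fun i hi => ?_
  rw [intervalIntegral.integral_finsetSum
    fun _ _ => Continuous.intervalIntegrable (by fun_prop) _ _, Finset.sum_congr rfl (h_orth i hi),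
    Finset.sum_ite_eq, if_pos hi]

/-- The lacunary sine sum with the dyadic frequencies `1, 2, …, 2 ^ (N - 1)`. -/
noncomputable def lacunarySin (N : ℕ) (x : ℝ) : ℝ := ∑ k ∈ Finset.range N, sin (2 ^ k * x)

@[fun_prop]
theorem continuous_lacunarySin (N : ℕ) : Continuous (lacunarySin N) := by
  unfold lacunarySin
  fun_prop

theorem eLpNorm_two_lacunarySin (N : ℕ) :
    eLpNorm (lacunarySin N) 2 (volume.restrict (Set.Ioc 0 (2 * π))) =
      ENNReal.ofReal √(N * π) := by
  have h_mem : MemLp (lacunarySin N) 2 (volume.restrict (Set.Ioc 0 (2 * π))) :=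
    (memLp_two_iff_integrable_sq (by fun_prop)).2 ((by fun_prop : Continuous _).integrableOn_Ioc)
  have h_int : ∫ x in 0..2 * π, lacunarySin N x ^ 2 = N * π := by
    simpa [lacunarySin] using integral_sq_sum_mul_sin (Finset.range N) 1 (n := fun k => 2 ^ k)
      (by simp) (Nat.pow_right_injective le_rfl).injOn
  rw [intervalIntegral.integral_of_le two_pi_pos.le] at h_int
  rw [h_mem.eLpNorm_eq_integral_rpow_norm two_ne_zero ENNReal.ofNat_ne_top, ← h_int, sqrt_eq_rpow]
  simp

theorem tendsto_eLpNorm_top_of_le {α ι E : Type*} {m : MeasurableSpace α} {μ : Measure α}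
    [IsFiniteMeasure μ] [NormedAddCommGroup E] {f : ι → α → E} {l : Filter ι} {p q : ℝ≥0∞}
    (hpq : p ≤ q) (hf : ∀ i, AEStronglyMeasurable (f i) μ)
    (h : Tendsto (fun i => eLpNorm (f i) p μ) l (𝓝 ∞)) :
    Tendsto (fun i => eLpNorm (f i) q μ) l (𝓝 ∞) := by
  rcases eq_or_ne μ 0 with rfl | hμ
  · simpa using h
  set D := μ Set.univ ^ (1 / p.toReal - 1 / q.toReal)
  have hD : D ≠ ∞ :=
    ENNReal.rpow_ne_top_of_ne_zero (Measure.measure_univ_ne_zero.2 hμ) (measure_ne_top _ _)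
  have h_div : Tendsto (fun i => eLpNorm (f i) p μ / D) l (𝓝 ∞) := by
    simpa [ENNReal.top_div, hD] using
      ENNReal.Tendsto.div_const (b := D) h (.inl ENNReal.top_ne_zero)
  exact tendsto_nhds_top_mono' h_div fun i => ENNReal.div_le_of_le_mul
    (eLpNorm_le_eLpNorm_mul_rpow_measure_univ hpq (hf i))

theorem tendsto_eLpNorm_lacunarySin {p : ℝ≥0∞} (hp : 2 ≤ p) :
    Tendsto (fun N => eLpNorm (lacunarySin N) p (volume.restrict (Set.Ioc 0 (2 * π)))) atTop
      (𝓝 ∞) := by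
  refine tendsto_eLpNorm_top_of_le hp (fun N => by fun_prop) ?_
  simp only [eLpNorm_two_lacunarySin]
  exact ENNReal.tendsto_ofReal_atTop.comp <| tendsto_sqrt_atTop.comp <|
    tendsto_natCast_atTop_atTop.atTop_mul_const pi_pos

end LacunarySines

section MixedNorms

variable {E F : Type*} [NormedAddCommGroup E] [NormedAddCommGroup F] {p : ℝ≥0∞}
  {f : ℝ² → F}

theorem eLpNorm_restrict_le_normLinftyYLpX {g : ℝ → E} {s : Set ℝ} (hs : MeasurableSet s) {y₀ : ℝ}
    (h : ∀ᶠ y in 𝓝 y₀, ∀ x ∈ s, ‖g x‖ ≤ ‖f !₂[x, y]‖) :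
    eLpNorm g p (volume.restrict s) ≤ normLinftyYLpX p f := by
  have h_freq : ∃ᵐ y, ∀ x ∈ s, ‖g x‖ ≤ ‖f !₂[x, y]‖ :=
    frequently_ae_iff.2 (Measure.measure_pos_of_mem_nhds volume h).ne'
  obtain ⟨y, hy, hy_sup⟩ := (h_freq.and_eventually (ae_le_eLpNormEssSup
    (f := fun y => eLpNorm (fun x => f !₂[x, y]) p volume))).exists
  calc eLpNorm g p (volume.restrict s)
      ≤ eLpNorm (fun x => f !₂[x, y]) p (volume.restrict s) :=
        eLpNorm_mono_ae ((ae_restrict_mem hs).mono hy)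
    _ ≤ eLpNorm (fun x => f !₂[x, y]) p volume := eLpNorm_mono_measure _ Measure.restrict_le_self
    _ ≤ normLinftyYLpX p f := by simpa [normLinftyYLpX] using hy_sup

theorem normLpXLinftyY_le_eLpNorm {G : ℝ → ℝ} (h : ∀ x y, ‖f !₂[x, y]‖ ≤ G x) :
    normLpXLinftyY p f ≤ eLpNorm G p volume := by
  refine eLpNorm_mono_enorm fun x => ?_
  rw [enorm_eq_self, eLpNorm_exponent_top]
  exact eLpNormEssSup_le_of_ae_enorm_bound
    (.of_forall fun y => enorm_le_iff_norm_le.2 ((h x y).trans (le_abs_self _)))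

end MixedNorms

section Superposition

variable {F : Type*} [NormedAddCommGroup F] [NormedSpace ℝ F] {φ : ℝ → ℝ} {ψ : ℝ → F}
  {u : ℕ → 𝓢(ℝ², F)}

theorem exists_contDiff_hasCompactSupport_deriv_eventuallyEq (c : F) :
    ∃ ψ : ℝ → F, ContDiff ℝ (⊤ : ℕ∞) ψ ∧ HasCompactSupport ψ ∧ ψ 0 = 0 ∧
      deriv ψ =ᶠ[𝓝 0] fun _ => c := by
  let χ : ContDiffBump (0 : ℝ) := default
  refine ⟨fun t => χ t • t • c, χ.contDiff.smul (by fun_prop), χ.hasCompactSupport.smul_right,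
    by simp, ?_⟩
  have h_linear : (fun t => χ t • t • c) =ᶠ[𝓝 0] fun t => t • c := by
    filter_upwards [χ.eventuallyEq_one] with t ht
    rw [ht, Pi.one_apply, one_smul]
  filter_upwards [h_linear.deriv] with t ht
  rw [ht, deriv_smul_const differentiableAt_id, deriv_id'', one_smul]

/- Since `ψ'' - ψ` vanishes at the origin and outside a bounded set, at every `y` the terms
`(ψ'' - ψ)(2 ^ k y)` of the Laplacian add up like a geometric series. -/
theorem exists_memLp_forall_norm_laplacian_sum_le
    (hφ : ContDiff ℝ (⊤ : ℕ∞) φ) (hφ_supp : HasCompactSupport φ)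
    (hψ : ContDiff ℝ (⊤ : ℕ∞) ψ) (hψ_supp : HasCompactSupport ψ)
    (hψ₀ : deriv (deriv ψ) 0 = ψ 0) (hu : ∀ k, ⇑(u k) = wavePacket φ ψ (2 ^ k)) :
    ∃ G : ℝ → ℝ, (∀ p, MemLp G p volume) ∧
      ∀ N x y, ‖Δ (∑ k ∈ Finset.range N, u k) !₂[x, y]‖ ≤ G x := by
  have hφ' := (contDiff_infty_iff_deriv.1 hφ).2
  have hφ'' := (contDiff_infty_iff_deriv.1 hφ').2
  have hψ'' := (contDiff_infty_iff_deriv.1 (contDiff_infty_iff_deriv.1 hψ).2).2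
  obtain ⟨B, hB⟩ := hψ_supp.exists_bound_of_continuous hψ.continuous
  have hB₀ : 0 ≤ B := (norm_nonneg _).trans (hB 0)
  obtain ⟨M, hM⟩ := exists_sum_norm_comp_two_pow_smul_le (h := fun t => deriv (deriv ψ) t - ψ t)
    (contDiff_infty.1 (hψ''.sub hψ) 1) (hψ_supp.deriv.deriv.sub hψ_supp) (sub_eq_zero.2 hψ₀)
  have h_mem {f : ℝ → ℝ} (hf : Continuous f) (hf_supp : HasCompactSupport f) (p : ℝ≥0∞) :
      MemLp (fun x => |f x|) p volume := (hf.memLp_of_hasCompactSupport hf_supp).norm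
  refine ⟨fun x => 2 * B * (|deriv (deriv φ) x| + 2 * |deriv φ x|) + M * |φ x|,
    fun p => ?_, fun N x y => ?_⟩
  · exact (((h_mem hφ''.continuous hφ_supp.deriv.deriv p).add
      ((h_mem hφ'.continuous hφ_supp.deriv p).const_mul 2)).const_mul _).add
        ((h_mem hφ.continuous hφ_supp p).const_mul M)
  have h_geom : ∑ k ∈ Finset.range N, ((2 : ℝ) ^ k)⁻¹ ≤ 2 := by
    simpa using sum_geometric_two_le N
  rw [← SchwartzMap.laplacianCLM_eq', map_sum, sum_apply]
  calc _ ≤ ∑ k ∈ Finset.range N, (B * (|deriv (deriv φ) x| + 2 * |deriv φ x|) * (2 ^ k)⁻¹ +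
          |φ x| * ‖deriv (deriv ψ) (2 ^ k * y) - ψ (2 ^ k * y)‖) :=
        norm_sum_le_of_le _ fun k _ => norm_laplacian_apply_le_of_coe_eq_wavePacket (hu k)
          (contDiff_infty.1 hφ 2) (contDiff_infty.1 hψ 2) (one_le_pow₀ one_le_two) hB x y
    _ ≤ B * (|deriv (deriv φ) x| + 2 * |deriv φ x|) * 2 + |φ x| * M := by
        rw [Finset.sum_add_distrib, ← Finset.mul_sum, ← Finset.mul_sum]
        gcongr
        exact hM N y
    _ = _ := by ring

theorem eventually_mixedDeriv_sum_eq {s : Set ℝ} {c : F} (hφ : Differentiable ℝ φ)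
    (hφ_one : ∀ x ∈ s, φ =ᶠ[𝓝 x] 1) (hψ : Differentiable ℝ ψ) (hψ₀ : deriv ψ =ᶠ[𝓝 0] fun _ => c)
    (hu : ∀ k, ⇑(u k) = wavePacket φ ψ (2 ^ k)) (N : ℕ) :
    ∀ᶠ y in 𝓝 (0 : ℝ), ∀ x ∈ s,
      (∂_{e₁} (∂_{e₂} (∑ k ∈ Finset.range N, u k))) !₂[x, y] = -lacunarySin N x • c := by
  have h_dilate (k : ℕ) : ∀ᶠ y in 𝓝 (0 : ℝ), deriv ψ (2 ^ k * y) = c :=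
    (continuous_const_mul ((2 : ℝ) ^ k)).tendsto' 0 0 (mul_zero _) |>.eventually hψ₀
  filter_upwards [(Finset.eventually_all (Finset.range N)).2 fun k _ => h_dilate k] with y hy x hx
  have hφ_x : φ x = 1 := (hφ_one x hx).eq_of_nhds
  have hφ'_x : deriv φ x = 0 := by simp [(hφ_one x hx).deriv_eq]
  simp only [LineDeriv.lineDerivOp_sum, sum_apply]
  rw [lacunarySin, ← Finset.sum_neg_distrib, Finset.sum_smul]
  refine Finset.sum_congr rfl fun k hk => ?_
  rw [mixedDeriv_apply_of_coe_eq_wavePacket (hu k) hφ hψ (by positivity), hφ_x, hφ'_x, hy k hk]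
  simp

theorem exists_lacunary_schwartzMap (c : F) :
    ∃ (u : ℕ → 𝓢(ℝ², F)) (G : ℝ → ℝ), (∀ p, MemLp G p volume) ∧
      (∀ N x y, ‖Δ (u N) !₂[x, y]‖ ≤ G x) ∧
      ∀ N, ∀ᶠ y in 𝓝 (0 : ℝ), ∀ x ∈ Set.Ioc 0 (2 * π),
        (∂_{e₁} (∂_{e₂} (u N))) !₂[x, y] = -lacunarySin N x • c := by
  obtain ⟨ψ, hψ, hψ_supp, hψ₀, hψ'⟩ :=
    exists_contDiff_hasCompactSupport_deriv_eventuallyEq c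
  let φ : ContDiffBump (0 : ℝ) := ⟨3 * π, 4 * π, by positivity, by linarith [pi_pos]⟩
  have hφ_one : ∀ x ∈ Set.Ioc 0 (2 * π), φ =ᶠ[𝓝 x] 1 := fun x hx =>
    φ.eventuallyEq_one_of_mem_ball (by
      rw [mem_ball_zero_iff, norm_of_nonneg hx.1.le]
      linarith [hx.2, pi_pos])
  have hψ'' : deriv (deriv ψ) 0 = ψ 0 := by rw [hψ'.deriv_eq, deriv_const, hψ₀]
  choose w hw using fun k : ℕ => exists_schwartzMap_coe_eq_wavePacket φ.contDiff
    φ.hasCompactSupport hψ hψ_supp (pow_ne_zero k (two_ne_zero (α := ℝ)))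
  obtain ⟨G, hG, hΔ⟩ := exists_memLp_forall_norm_laplacian_sum_le φ.contDiff φ.hasCompactSupport
    hψ hψ_supp hψ'' hw
  exact ⟨fun N => ∑ k ∈ Finset.range N, w k, G, hG, hΔ,
    eventually_mixedDeriv_sum_eq (φ.contDiff.differentiable one_ne_zero) hφ_one
      (hψ.differentiable (by simp)) hψ' hw⟩

end Superposition

theorem corollary2p6_general {F : Type*} [NormedAddCommGroup F] [NormedSpace ℝ F] [Nontrivial F]
    (p : ℝ≥0∞) (hp : 2 ≤ p) :
    ¬ ∃ C : ℝ≥0, ∀ u : 𝓢(ℝ², F),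
      normLinftyYLpX p (∂_{e₁} (∂_{e₂} u) : 𝓢(ℝ², F)) ≤
        (C : ℝ≥0∞) * normLpXLinftyY p (Δ u : 𝓢(ℝ², F)) := by
  rintro ⟨C, hC⟩
  obtain ⟨c, hc⟩ := exists_norm_eq F zero_le_one
  obtain ⟨u, G, hG, hΔ, hxy⟩ := exists_lacunary_schwartzMap c
  have h_bound (N : ℕ) : eLpNorm (lacunarySin N) p (volume.restrict (Set.Ioc 0 (2 * π))) ≤
      C * eLpNorm G p volume :=
    calc _ ≤ normLinftyYLpX p (∂_{e₁} (∂_{e₂} (u N)) : 𝓢(ℝ², F)) := by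
          refine eLpNorm_restrict_le_normLinftyYLpX measurableSet_Ioc <|
            (hxy N).mono fun y h x hx => ?_
          rw [h x hx, norm_smul, norm_neg, hc, mul_one]
      _ ≤ C * normLpXLinftyY p (Δ (u N) : 𝓢(ℝ², F)) := hC (u N)
      _ ≤ C * eLpNorm G p volume := by gcongr; exact normLpXLinftyY_le_eLpNorm (hΔ N)
  have h_top : ∞ ≤ C * eLpNorm G p volume :=
    le_of_tendsto' (tendsto_eLpNorm_lacunarySin hp) h_bound
  exact (ENNReal.mul_lt_top ENNReal.coe_lt_top (hG p).eLpNorm_lt_top).not_ge h_top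

/-- Here `EuclideanSpace.single 0 1` and `EuclideanSpace.single 1 1` are the coordinate directions
of `x` and `y`, so the left side is the mixed norm of `∂_x ∂_y u`. -/
theorem corollary2p6 {𝕜 : Type*} [RCLike 𝕜] (p : ℝ≥0∞) (hp : 2 ≤ p) :
    ¬ ∃ C : ℝ≥0, ∀ u : 𝓢(EuclideanSpace ℝ (Fin 2), 𝕜),
      normLinftyYLpX p
          (∂_{(EuclideanSpace.single 0 1 : EuclideanSpace ℝ (Fin 2))}
            (∂_{(EuclideanSpace.single 1 1 : EuclideanSpace ℝ (Fin 2))} u) :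
              𝓢(EuclideanSpace ℝ (Fin 2), 𝕜)) ≤
        (C : ℝ≥0∞) * normLpXLinftyY p (Δ u : 𝓢(EuclideanSpace ℝ (Fin 2), 𝕜)) :=
  corollary2p6_general p hp
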